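/- **Theorem 4 (Compatibility with sufficient statistics).** Setting. Let $\mathcal M=\{p(x|\theta),\ x\in\mathcal X,\ \theta\in\Theta\}$ be a statistical model: $dx$ and $d\theta$ are $\sigma$-finite measures on $\mathcal X$ and $\Theta$ (for instance Lebesgue measure on measurable subsets of Euclidean spaces), $p(x|\theta)\in[0,\infty)$ is jointly measurable, and $\int p(x|\theta)\,dx=1$ for every $\theta$. A proper prior is a measurable $\pi\colon\Theta\to[0,\infty)$ with $\int\pi(\theta)\,d\theta=1$. Put $p(x|\pi)=\int p(x|\theta)\pi(\theta)\,d\theta$, $$L(\pi\,|\,\mathcal M,X)=\prod_{m=1}^M p(x_m|\pi)\quad\text{for data } X=(x_1,\dots,x_M)\in\mathcal X^M,$$ $$\mathcal I[\pi\,|\,\mathcal M]=\int_\Theta\int_{\mathcal X}\pi(\theta)\,p(x|\theta)\log\frac{p(x|\theta)}{p(x|\pi)}\,dx\,d\theta\in[0,\infty],$$ and let $\mathcal M^k$ be the model of $k$ independent replications, with densities $\prod_{i=1}^k p(x^{(i)}|\theta)$ on $\mathcal X^k$. For a set $\mathcal P$ of functions $\Theta\to[0,\infty)$ and $\gamma>0$,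 an *empirical reference prior* for $(\mathcal M,\mathcal P,X,\gamma)$ is a proper prior $\pi\in\mathcal P$ such that for every proper prior $\tilde\pi\in\mathcal P$ $$\lim_{k\to\infty}\Big(\big(\log L(\pi\,|\,\mathcal M,X)+\gamma\,\mathcal I[\pi\,|\,\mathcal M^k]\big)-\big(\log L(\tilde\pi\,|\,\mathcal M,X)+\gamma\,\mathcal I[\tilde\pi\,|\,\mathcal M^k]\big)\Big)$$ exists in $[-\infty,\infty]$ and is $\ge 0$ (extended real values, $\log 0=-\infty$; an indeterminate sum or difference $\infty-\infty$ is read as $-\infty$). Let $t\colon\mathcal X\to\mathcal T$ be a sufficient statistic, i.e. $t$ is measurable and for every measurable $A\subseteq\mathcal X$ the conditional probability of $A$ given $t$ has a version that does not depend on $\theta$. Let $\mathcal M_t=\{p(t|\theta),\ t\in\mathcal T,\ \theta\in\Theta\}$ be a model (with respect to some $\sigma$-finite measure on $\mathcal T$, the densities being jointly measurable) such that $p(\cdot|\theta)$ is a density of the law of $t(x)$ under $p(x|\theta)\,dx$, for every $\theta$. For data $X$ write $T=(t(x_1),\dots,t(x_M))$. Claim. 1. $\mathcal I[\pi\,|\,\mathcal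 M^k]=\mathcal I[\pi\,|\,\mathcal M_t^k]$ for every proper prior $\pi$ and every $k\in\mathbb N$. 2. Let $p_0$ be any proper prior (the true one) and $M\in\mathbb N$. For almost every data set $X$ of $M$ independent samples from $p(x|p_0)$, the following holds: there is a constant $C\in\mathbb R$ with $\log L(\pi\,|\,\mathcal M,X)=C+\log L(\pi\,|\,\mathcal M_t,T)$ for all proper priors $\pi$; and for all $\mathcal P$ and all $\gamma>0$, a function is an empirical reference prior for $(\mathcal M,\mathcal P,X,\gamma)$ if and only if it is one for $(\mathcal M_t,\mathcal P,T,\gamma)$. 3. The conclusions of 2 hold moreover for every individual data set $X$ such that for each $m$ there is $c_m\in(0,\infty)$ with $p(x_m|\theta)=c_m\,p(t(x_m)|\theta)$ for almost every $\theta$. -/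

import Mathlib

open MeasureTheory Filter Topology
open scoped ENNReal NNReal

namespace EmpiricalBayes

noncomputable section

/-- A dominated statistical model: a family `p(x|θ)` of probability densities on the sample space,
jointly measurable in `(x, θ)`, with respect to a `σ`-finite reference measure `dx`.
Lebesgue measure on a measurable subset of `ℝⁿ` is the typical reference measure. -/
structure Model (𝒳 Θ : Type*) [MeasurableSpace 𝒳] [MeasurableSpace Θ] where
  /-- the reference measure `dx` on the sample space -/
  ref : Measure 𝒳
  /-- the reference measure is `σ`-finite -/
  sigmaFinite_ref : SigmaFinite ref
  /-- the density `p(x|θ)` -/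
  p : 𝒳 → Θ → ℝ≥0
  /-- joint measurability of the density -/
  measurable_p : Measurable (Function.uncurry p)
  /-- each `p(·|θ)` is a probability density -/
  lintegral_p : ∀ θ, ∫⁻ x, p x θ ∂ref = 1

variable {𝒳 𝒯 Θ : Type*} [MeasurableSpace 𝒳] [MeasurableSpace 𝒯] [MeasurableSpace Θ]

/-- The law `p(x|θ) dx` of one observation, given the parameter `θ`. -/
def Model.law (M : Model 𝒳 Θ) (θ : Θ) : Measure 𝒳 :=
  M.ref.withDensity fun x => M.p x θ

/-- The model of `k` independent replications of the entire experiment, with densities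
`∏ i, p(x i|θ)` on `𝒳ᵏ`. -/
def Model.replicate (M : Model 𝒳 Θ) (k : ℕ) : Model (Fin k → 𝒳) Θ where
  ref := Measure.pi fun _ => M.ref
  sigmaFinite_ref := by
    have := M.sigmaFinite_ref
    infer_instance
  p x θ := ∏ i, M.p (x i) θ
  measurable_p := by
    refine Finset.measurable_prod _ fun i _ => ?_
    exact M.measurable_p.comp
      (f := fun z : (Fin k → 𝒳) × Θ => (z.1 i, z.2))
      (((measurable_pi_apply i).comp measurable_fst).prodMk measurable_snd)
  lintegral_p θ := by
    have := M.sigmaFinite_ref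
    have hm : Measurable fun x => M.p x θ :=
      M.measurable_p.comp (f := fun x : 𝒳 => (x, θ)) (measurable_id.prodMk measurable_const)
    have hi : Integrable (fun x => (M.p x θ : ℝ)) M.ref := by
      refine ⟨hm.coe_nnreal_real.aestronglyMeasurable, ?_⟩
      simp [HasFiniteIntegral, M.lintegral_p]
    have h1 : ∫ x, (M.p x θ : ℝ) ∂M.ref = 1 := by
      rw [integral_eq_lintegral_of_nonneg_ae (Eventually.of_forall fun _ => NNReal.coe_nonneg _)
        hi.aestronglyMeasurable]
      simp [M.lintegral_p]
    have hpi := ofReal_integral_eq_lintegral_ofReal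
      (Integrable.fintype_prod (f := fun (_ : Fin k) x => (M.p x θ : ℝ)) fun _ => hi)
      (Eventually.of_forall fun x => Finset.prod_nonneg fun _ _ => NNReal.coe_nonneg _)
    rw [integral_fintype_prod_eq_prod (μ := fun _ : Fin k => M.ref)
      (fun (_ : Fin k) x => (M.p x θ : ℝ))] at hpi
    simp only [h1, Finset.prod_const_one, ENNReal.ofReal_one] at hpi
    rw [hpi]
    refine lintegral_congr fun x => ?_
    rw [← NNReal.coe_prod, ENNReal.ofReal_coe_nnreal]

/-- `t` is a sufficient statistic: the conditional probability of every event `A`, given `t`, has a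
version `f(t)` that does not depend on the parameter. -/
def Model.IsSufficient (M : Model 𝒳 Θ) (t : 𝒳 → 𝒯) : Prop :=
  Measurable t ∧ ∀ A : Set 𝒳, MeasurableSet A → ∃ f : 𝒯 → ℝ≥0∞, Measurable f ∧
    ∀ θ, ∀ B : Set 𝒯, MeasurableSet B →
      M.law θ (A ∩ t ⁻¹' B) = ∫⁻ s in B, f s ∂((M.law θ).map t)

/-- `Mt` is the model `p(t|θ)` of the statistic `t(x)`: its densities are densities of the law of
`t(x)` given `θ`. -/
def Model.IsModelOfStatistic (M : Model 𝒳 Θ) (t : 𝒳 → 𝒯) (Mt : Model 𝒯 Θ) : Prop :=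
  ∀ θ, (M.law θ).map t = Mt.law θ

/-- `π` is a proper prior, i.e. a probability density with respect to the reference measure
`τ = dθ` on the parameter space. -/
def IsProperPrior (τ : Measure Θ) (π : Θ → ℝ≥0) : Prop :=
  Measurable π ∧ ∫⁻ θ, π θ ∂τ = 1

/-- The prior predictive density `p(x|π) = ∫ p(x|θ) π(θ) dθ`. -/
def Model.predictive (M : Model 𝒳 Θ) (τ : Measure Θ) (π : Θ → ℝ≥0) (x : 𝒳) : ℝ≥0∞ :=
  ∫⁻ θ, M.p x θ * π θ ∂τ

/-- The prior predictive law `p(x|π) dx`. -/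
def Model.predictiveLaw (M : Model 𝒳 Θ) (τ : Measure Θ) (π : Θ → ℝ≥0) : Measure 𝒳 :=
  M.ref.withDensity (M.predictive τ π)

/-- The marginal log-likelihood `log L(π)`, `L(π) = ∏ m, p(x m|π)`, as an extended real number
(`log 0 = -∞`). -/
def Model.logL (M : Model 𝒳 Θ) (τ : Measure Θ) {n : ℕ} (X : Fin n → 𝒳) (π : Θ → ℝ≥0) : EReal :=
  ENNReal.log (∏ m, M.predictive τ π (X m))

/-- The expected information `∫∫ π(θ) p(x|θ) log (p(x|θ) / p(x|π)) dx dθ` as an extended real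
number, i.e. the integral of the positive part minus the integral of the negative part.
The latter is finite for a proper prior, because `r log r ≥ -1/e`. -/
def Model.info (M : Model 𝒳 Θ) (τ : Measure Θ) (π : Θ → ℝ≥0) : EReal :=
  ((∫⁻ θ, ∫⁻ x, π θ * M.p x θ *
      (ENNReal.log (M.p x θ / M.predictive τ π x)).toENNReal ∂M.ref ∂τ : ℝ≥0∞) : EReal) -
    ((∫⁻ θ, ∫⁻ x, π θ * M.p x θ *
      (-ENNReal.log (M.p x θ / M.predictive τ π x)).toENNReal ∂M.ref ∂τ : ℝ≥0∞) : EReal)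

/-- `π` is an empirical reference prior for the model `M`, the prior class `𝒬`, the data `X` and
the smoothing parameter `γ`: it is a proper prior in `𝒬` such that for every proper prior `π'` in
`𝒬` the differences of the values of `log L + γ I[· | Mᵏ]` at `π` and at `π'` have a limit in
`[0, ∞]` as `k → ∞`. A difference of the form `∞ - ∞` is `-∞` in `EReal`, so an undefined
difference never counts in favour of `π`. -/
def Model.IsEmpiricalReferencePrior (M : Model 𝒳 Θ) (τ : Measure Θ) (𝒬 : Set (Θ → ℝ≥0))
    {n : ℕ} (X : Fin n → 𝒳) (γ : ℝ) (π : Θ → ℝ≥0) : Prop :=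
  π ∈ 𝒬 ∧ IsProperPrior τ π ∧ ∀ π' ∈ 𝒬, IsProperPrior τ π' →
    ∃ l : EReal, 0 ≤ l ∧ Tendsto
      (fun k : ℕ =>
        (M.logL τ X π + (γ : EReal) * (M.replicate k).info τ π) -
          (M.logL τ X π' + (γ : EReal) * (M.replicate k).info τ π'))
      atTop (𝓝 l)

end

end EmpiricalBayes

namespace EmpiricalBayes

/-! The core is the factorization `p(x|θ) = h(x) p(t(x)|θ)` almost everywhere (`exists_factorizes`).
Mix all laws with a positive weight `w` of finite mass into `Q`, with density `q`, and let `q_t` be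
the corresponding mixture for the statistic. Integrating the parameter-free conditional probability
against `w` shows that it also serves `Q`. Hence almost every law has `Q`-density `p(t(x)|θ) /
q_t(t(x))`, and `h = q / (q_t ∘ t)`.

The factor `h` cancels in `p(x|θ) / p(x|π)`, so the information integrand depends on `x` only
through `t(x)`, and a change of variables gives `info_eq`. Replication preserves the factorization,
with factor `∏ i, h (x i)`. At the data the factor is almost surely finite and positive, so it
shifts every log-likelihood by the same constant, which drops out of the limits that define
reference priors. -/

/-- Tonelli's theorem for a product of functions of the individual coordinates. -/
theorem lintegral_fin_prod_eq_prod {α : Type*} [MeasurableSpace α] (μ : Measure α) [SigmaFinite μ]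
    {n : ℕ} {f : Fin n → α → ℝ≥0∞} (hf : ∀ i, Measurable (f i)) :
    ∫⁻ x : Fin n → α, ∏ i, f i (x i) ∂(Measure.pi fun _ => μ) = ∏ i, ∫⁻ x, f i x ∂μ := by
  induction n with
  | zero => simp
  | succ n ih =>
    have hm : Measurable fun x : Fin n → α => ∏ i, f (Fin.succ i) (x i) :=
      Finset.measurable_prod _ fun i _ => (hf i.succ).comp (measurable_pi_apply i)
    rw [← ((measurePreserving_piFinSuccAbove (fun _ : Fin (n + 1) => μ) 0).symm).lintegral_comp_emb
      (MeasurableEquiv.measurableEmbedding _)]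
    simp_rw [MeasurableEquiv.piFinSuccAbove_symm_apply, Fin.insertNthEquiv,
      Fin.prod_univ_succ, Fin.insertNth_zero, Equiv.coe_fn_mk, Fin.cons_succ, Fin.cons_zero]
    rw [← ih fun i => hf i.succ]
    exact lintegral_prod_mul (hf 0).aemeasurable hm.aemeasurable

section Model

variable {𝒳 𝒯 Θ : Type*} [MeasurableSpace 𝒳] [MeasurableSpace 𝒯] [MeasurableSpace Θ]

/-! ### Laws, predictive laws and domination -/

theorem Model.measurable_p_coe (M : Model 𝒳 Θ) :
    Measurable fun z : 𝒳 × Θ => (M.p z.1 z.2 : ℝ≥0∞) :=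
  M.measurable_p.coe_nnreal_ennreal

theorem Model.measurable_p_left (M : Model 𝒳 Θ) (θ : Θ) :
    Measurable fun x => (M.p x θ : ℝ≥0∞) :=
  M.measurable_p_coe.comp (measurable_id.prodMk measurable_const)

theorem Model.measurable_p_right (M : Model 𝒳 Θ) (x : 𝒳) :
    Measurable fun θ => (M.p x θ : ℝ≥0∞) :=
  M.measurable_p_coe.comp (measurable_const.prodMk measurable_id)

theorem Model.measurable_predictive (M : Model 𝒳 Θ) (τ : Measure Θ) [SFinite τ] {π : Θ → ℝ≥0}
    (hπ : Measurable π) : Measurable (M.predictive τ π) :=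
  (M.measurable_p_coe.mul (hπ.comp measurable_snd).coe_nnreal_ennreal).lintegral_prod_right'

instance (M : Model 𝒳 Θ) (θ : Θ) : IsProbabilityMeasure (M.law θ) :=
  ⟨by simp [Model.law, M.lintegral_p]⟩

theorem Model.lintegral_law (M : Model 𝒳 Θ) (θ : Θ) {f : 𝒳 → ℝ≥0∞} (hf : Measurable f) :
    ∫⁻ x, f x ∂M.law θ = ∫⁻ x, M.p x θ * f x ∂M.ref :=
  lintegral_withDensity_eq_lintegral_mul _ (M.measurable_p_left θ) hf

/-- The predictive law is the mixture of the laws given the parameter. -/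
theorem Model.lintegral_predictiveLaw (M : Model 𝒳 Θ) (τ : Measure Θ) [SFinite τ] {π : Θ → ℝ≥0}
    (hπ : Measurable π) {f : 𝒳 → ℝ≥0∞} (hf : Measurable f) :
    ∫⁻ x, f x ∂M.predictiveLaw τ π = ∫⁻ θ, π θ * ∫⁻ x, f x ∂M.law θ ∂τ := by
  have := M.sigmaFinite_ref
  rw [Model.predictiveLaw, lintegral_withDensity_eq_lintegral_mul _ (M.measurable_predictive τ hπ) hf]
  have h1 : ∀ x, (M.predictive τ π * f) x = ∫⁻ θ, M.p x θ * π θ * f x ∂τ := fun x =>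
    (lintegral_mul_const _ ((M.measurable_p_right x).mul hπ.coe_nnreal_ennreal)).symm
  simp_rw [h1]
  rw [lintegral_lintegral_swap]
  · refine lintegral_congr fun θ => ?_
    rw [M.lintegral_law θ hf, ← lintegral_const_mul _ ((M.measurable_p_left θ).fun_mul hf)]
    exact lintegral_congr fun x => by ring
  · exact ((M.measurable_p_coe.mul (hπ.comp measurable_snd).coe_nnreal_ennreal).mul
      (hf.comp measurable_fst)).aemeasurable

theorem Model.predictiveLaw_apply (M : Model 𝒳 Θ) (τ : Measure Θ) [SFinite τ] {π : Θ → ℝ≥0}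
    (hπ : Measurable π) {A : Set 𝒳} (hA : MeasurableSet A) :
    M.predictiveLaw τ π A = ∫⁻ θ, π θ * M.law θ A ∂τ := by
  simpa [lintegral_indicator_one hA] using
    M.lintegral_predictiveLaw τ hπ (measurable_one.indicator hA : Measurable (A.indicator 1))

theorem Model.lintegral_predictive (M : Model 𝒳 Θ) (τ : Measure Θ) [SFinite τ] {π : Θ → ℝ≥0}
    (hπ : Measurable π) : ∫⁻ x, M.predictive τ π x ∂M.ref = ∫⁻ θ, π θ ∂τ := by
  have h := M.predictiveLaw_apply τ hπ MeasurableSet.univ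
  simpa [Model.predictiveLaw] using h

theorem Model.ae_ae_comm (M : Model 𝒳 Θ) (τ : Measure Θ) [SFinite τ] {g : 𝒳 → Θ → ℝ≥0∞}
    (hg : Measurable fun z : 𝒳 × Θ => g z.1 z.2) :
    (∀ᵐ x ∂M.ref, ∀ᵐ θ ∂τ, (M.p x θ : ℝ≥0∞) = g x θ) ↔
      ∀ᵐ θ ∂τ, ∀ᵐ x ∂M.ref, (M.p x θ : ℝ≥0∞) = g x θ := by
  have := M.sigmaFinite_ref
  exact Measure.ae_ae_comm (measurableSet_eq_fun M.measurable_p_coe hg)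

/-- Where the predictive density of an everywhere positive prior vanishes, so do almost all
densities. -/
theorem Model.ae_eq_zero_of_predictive_eq_zero (M : Model 𝒳 Θ) (τ : Measure Θ) {w : Θ → ℝ≥0}
    (hw : Measurable w) (hpos : ∀ θ, 0 < w θ) {x : 𝒳} (hx : M.predictive τ w x = 0) :
    ∀ᵐ θ ∂τ, (M.p x θ : ℝ≥0∞) = 0 := by
  rw [Model.predictive,
    lintegral_eq_zero_iff ((M.measurable_p_right x).fun_mul hw.coe_nnreal_ennreal)] at hx
  filter_upwards [hx] with θ h
  simpa [(hpos θ).ne'] using h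

/-- Almost every law has a density with respect to the predictive law of an everywhere positive
prior. -/
theorem Model.ae_law_eq_withDensity (M : Model 𝒳 Θ) (τ : Measure Θ) [SFinite τ] {w : Θ → ℝ≥0}
    (hw : Measurable w) (hpos : ∀ θ, 0 < w θ) (hfin : ∫⁻ θ, w θ ∂τ ≠ ∞) :
    ∀ᵐ θ ∂τ, M.law θ =
      (M.predictiveLaw τ w).withDensity fun x => M.p x θ / M.predictive τ w x := by
  have := M.sigmaFinite_ref
  have hq := M.measurable_predictive τ hw
  have htop : ∀ᵐ x ∂M.ref, M.predictive τ w x < ∞ :=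
    ae_lt_top hq (by rwa [M.lintegral_predictive τ hw])
  have hq2 : Measurable fun z : 𝒳 × Θ => M.predictive τ w z.1 := hq.comp measurable_fst
  have h : ∀ᵐ x ∂M.ref, ∀ᵐ θ ∂τ,
      (M.p x θ : ℝ≥0∞) = M.predictive τ w x * (M.p x θ / M.predictive τ w x) := by
    filter_upwards [htop] with x hx
    -- At a zero of the mixture density the quotient is useless, but there the densities vanish for
    -- almost every parameter.
    by_cases h0 : M.predictive τ w x = 0
    · filter_upwards [M.ae_eq_zero_of_predictive_eq_zero τ hw hpos h0] with θ hθ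
      simp [hθ]
    · exact Eventually.of_forall fun θ => (ENNReal.mul_div_cancel h0 hx.ne).symm
  rw [M.ae_ae_comm τ (hq2.mul (M.measurable_p_coe.div hq2))] at h
  filter_upwards [h] with θ hθ
  rw [Model.predictiveLaw, ← withDensity_mul _ hq ((M.measurable_p_left θ).fun_div hq)]
  exact withDensity_congr_ae hθ

/-! ### Factorization -/

/-- A model with a statistic factorizes if `p(x|θ) = h(x) p(t(x)|θ)` almost everywhere. -/
def Model.Factorizes (M : Model 𝒳 Θ) (τ : Measure Θ) (t : 𝒳 → 𝒯) (Mt : Model 𝒯 Θ)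
    (h : 𝒳 → ℝ≥0∞) : Prop :=
  Measurable h ∧ ∀ᵐ θ ∂τ, ∀ᵐ x ∂M.ref, (M.p x θ : ℝ≥0∞) = h x * Mt.p (t x) θ

/-- With `x` quantified first, one null set of `x` serves all priors at once. -/
theorem Model.Factorizes.ae_ae {M : Model 𝒳 Θ} {τ : Measure Θ} [SFinite τ] {t : 𝒳 → 𝒯}
    {Mt : Model 𝒯 Θ} {h : 𝒳 → ℝ≥0∞} (hF : M.Factorizes τ t Mt h) (ht : Measurable t) :
    ∀ᵐ x ∂M.ref, ∀ᵐ θ ∂τ, (M.p x θ : ℝ≥0∞) = h x * Mt.p (t x) θ := by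
  refine (M.ae_ae_comm τ ((hF.1.comp measurable_fst).mul ?_)).2 hF.2
  exact Mt.measurable_p_coe.comp ((ht.comp measurable_fst).prodMk measurable_snd)

/-- The factorization theorem for sufficient statistics. -/
theorem Model.IsSufficient.exists_factorizes {M : Model 𝒳 Θ} {τ : Measure Θ} [SigmaFinite τ]
    {t : 𝒳 → 𝒯} (hs : M.IsSufficient t) {Mt : Model 𝒯 Θ} (hMt : M.IsModelOfStatistic t Mt) :
    ∃ h, M.Factorizes τ t Mt h := by
  obtain ⟨ht, hs⟩ := hs
  obtain ⟨w, hpos, hw, hfin⟩ := exists_pos_lintegral_lt_of_sigmaFinite τ one_ne_zero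
  have hq := M.measurable_predictive τ hw
  have hqt := Mt.measurable_predictive τ hw
  refine ⟨fun x => M.predictive τ w x / Mt.predictive τ w (t x), hq.div (hqt.comp ht), ?_⟩
  filter_upwards [Mt.ae_law_eq_withDensity τ hw hpos (hfin.trans ENNReal.one_lt_top).ne] with θ hθ
  have hg : Measurable fun s => (Mt.p s θ : ℝ≥0∞) / Mt.predictive τ w s :=
    (Mt.measurable_p_left θ).div hqt
  have hgt : Measurable fun x => (Mt.p (t x) θ : ℝ≥0∞) / Mt.predictive τ w (t x) := hg.comp ht
  have hlaw : M.law θ = (M.predictiveLaw τ w).withDensity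
      fun x => (Mt.p (t x) θ : ℝ≥0∞) / Mt.predictive τ w (t x) := by
    ext A hA
    obtain ⟨f, hf, hfA⟩ := hs A hA
    -- The conditional probability `f` of `A` given `t` is the same for all parameters, hence also
    -- for their mixture.
    have hmap : ((M.predictiveLaw τ w).restrict A).map t =
        (Mt.predictiveLaw τ w).withDensity f := by
      ext B hB
      rw [Measure.map_apply ht hB, Measure.restrict_apply (ht hB), withDensity_apply _ hB,
        Set.inter_comm, M.predictiveLaw_apply τ hw (hA.inter (ht hB)), ← lintegral_indicator hB,
        Mt.lintegral_predictiveLaw τ hw (hf.indicator hB)]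
      refine lintegral_congr fun θ' => ?_
      rw [hfA θ' B hB, hMt θ', lintegral_indicator hB]
    have h1 : M.law θ A = ∫⁻ s, f s ∂Mt.law θ := by
      simpa [hMt θ] using hfA θ Set.univ MeasurableSet.univ
    rw [h1, hθ, lintegral_withDensity_eq_lintegral_mul _ hg hf, withDensity_apply _ hA,
      ← lintegral_map (f := fun s => (Mt.p s θ : ℝ≥0∞) / Mt.predictive τ w s) hg ht, hmap,
      lintegral_withDensity_eq_lintegral_mul _ hf hg]
    exact lintegral_congr fun s => mul_comm _ _
  -- Two densities of the same finite measure agree almost everywhere.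
  rw [Model.predictiveLaw, ← withDensity_mul _ hq hgt, Model.law,
    withDensity_eq_iff (M.measurable_p_left θ).aemeasurable (hq.mul hgt).aemeasurable
      (by simp [M.lintegral_p])] at hlaw
  filter_upwards [hlaw] with x hx
  rw [hx]
  simp only [Pi.mul_apply, div_eq_mul_inv]
  ring

/-- If `p(x|θ)` is a multiple of `p(t(x)|θ)` in `θ`, so is the predictive density. -/
theorem Model.predictive_eq_mul {M : Model 𝒳 Θ} {τ : Measure Θ} {Mt : Model 𝒯 Θ} {x : 𝒳} {s : 𝒯}
    {c : ℝ≥0∞} (h : ∀ᵐ θ ∂τ, (M.p x θ : ℝ≥0∞) = c * Mt.p s θ) {π : Θ → ℝ≥0} (hπ : Measurable π) :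
    M.predictive τ π x = c * Mt.predictive τ π s := by
  rw [Model.predictive, Model.predictive,
    ← lintegral_const_mul _ ((Mt.measurable_p_right s).fun_mul hπ.coe_nnreal_ennreal)]
  refine lintegral_congr_ae ?_
  filter_upwards [h] with θ hθ
  rw [hθ, mul_assoc]

/-! ### Expected information and replications -/

/-- The expected information of a factorizing model is that of the model of the statistic. -/
theorem Model.Factorizes.info_eq {M : Model 𝒳 Θ} {τ : Measure Θ} [SFinite τ] {t : 𝒳 → 𝒯}
    {Mt : Model 𝒯 Θ} {h : 𝒳 → ℝ≥0∞} (hF : M.Factorizes τ t Mt h) (ht : Measurable t)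
    (hMt : M.IsModelOfStatistic t Mt) {π : Θ → ℝ≥0} (hπ : Measurable π) :
    M.info τ π = Mt.info τ π := by
  have hpred : ∀ᵐ x ∂M.ref, M.predictive τ π x = h x * Mt.predictive τ π (t x) := by
    filter_upwards [hF.ae_ae ht] with x hx using Model.predictive_eq_mul hx hπ
  -- `Φ` will be the positive and the negative part of the logarithm.
  have key : ∀ Φ : ℝ≥0∞ → ℝ≥0∞, Measurable Φ →
      ∫⁻ θ, ∫⁻ x, π θ * M.p x θ * Φ (M.p x θ / M.predictive τ π x) ∂M.ref ∂τ =
        ∫⁻ θ, ∫⁻ s, π θ * Mt.p s θ * Φ (Mt.p s θ / Mt.predictive τ π s) ∂Mt.ref ∂τ := by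
    intro Φ hΦ
    refine lintegral_congr_ae ?_
    filter_upwards [hF.2] with θ hθ
    have hm : Measurable fun s => Φ (Mt.p s θ / Mt.predictive τ π s) :=
      hΦ.comp ((Mt.measurable_p_left θ).div (Mt.measurable_predictive τ hπ))
    have hmt : Measurable fun x => Φ (Mt.p (t x) θ / Mt.predictive τ π (t x)) := hm.comp ht
    have h2 : ∫⁻ s, π θ * Mt.p s θ * Φ (Mt.p s θ / Mt.predictive τ π s) ∂Mt.ref =
        ∫⁻ x, π θ * M.p x θ * Φ (Mt.p (t x) θ / Mt.predictive τ π (t x)) ∂M.ref := by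
      simp_rw [mul_assoc]
      rw [lintegral_const_mul _ ((Mt.measurable_p_left θ).fun_mul hm),
        lintegral_const_mul _ ((M.measurable_p_left θ).fun_mul hmt),
        ← Mt.lintegral_law θ hm, ← hMt θ, lintegral_map hm ht]
      exact congrArg _ (M.lintegral_law θ hmt)
    rw [h2]
    refine lintegral_congr_ae ?_
    filter_upwards [hθ, hpred] with x hx hp
    -- Where the density vanishes, so does the weight. Elsewhere `h x` is neither `0` nor `∞`, since
    -- the density is nonzero and finite, and it may be cancelled.
    by_cases h0 : (M.p x θ : ℝ≥0∞) = 0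
    · simp [h0]
    have hh0 : h x ≠ 0 := fun e => h0 (by rw [hx, e, zero_mul])
    have hhtop : h x ≠ ∞ := by
      intro e
      have hpt : (Mt.p (t x) θ : ℝ≥0∞) ≠ 0 := fun e' => h0 (by rw [hx, e', mul_zero])
      rw [e, ENNReal.top_mul hpt] at hx
      exact ENNReal.coe_ne_top hx
    have hr : (M.p x θ : ℝ≥0∞) / M.predictive τ π x =
        Mt.p (t x) θ / Mt.predictive τ π (t x) := by
      rw [hp, hx, ENNReal.mul_div_mul_left _ _ hh0 hhtop]
    rw [hr]
  have hlog : Measurable fun r : ℝ≥0∞ => (ENNReal.log r).toENNReal :=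
    ENNReal.measurable_log.ereal_toENNReal
  have hnlog : Measurable fun r : ℝ≥0∞ => (-ENNReal.log r).toENNReal :=
    ENNReal.measurable_log.neg.ereal_toENNReal
  rw [Model.info, Model.info, key _ hlog, key _ hnlog]

/-- On boxes both the indicator and the density split into coordinate factors, so Tonelli applies;
boxes determine the product measure. -/
theorem Model.law_replicate (M : Model 𝒳 Θ) (k : ℕ) (θ : Θ) :
    (M.replicate k).law θ = Measure.pi fun _ => M.law θ := by
  have := M.sigmaFinite_ref
  refine (Measure.pi_eq fun s hs => ?_).symm
  rw [Model.law, withDensity_apply _ (MeasurableSet.univ_pi hs),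
    ← lintegral_indicator (MeasurableSet.univ_pi hs)]
  have h : ∀ x : Fin k → 𝒳, (Set.univ.pi s).indicator
      (fun x => ((M.replicate k).p x θ : ℝ≥0∞)) x =
        ∏ i, (s i).indicator (fun x => (M.p x θ : ℝ≥0∞)) (x i) := by
    intro x
    by_cases hx : ∀ i, x i ∈ s i
    · simp [hx, Model.replicate]
    · obtain ⟨i, hi⟩ := not_forall.1 hx
      rw [Set.indicator_of_notMem (by simpa using hx)]
      exact (Finset.prod_eq_zero (Finset.mem_univ i) (Set.indicator_of_notMem hi _)).symm
  simp_rw [h]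
  refine (lintegral_fin_prod_eq_prod M.ref
    fun i => (M.measurable_p_left θ).indicator (hs i)).trans ?_
  refine Finset.prod_congr rfl fun i _ => ?_
  rw [lintegral_indicator (hs i), Model.law, withDensity_apply _ (hs i)]

theorem Model.IsModelOfStatistic.replicate {M : Model 𝒳 Θ} {t : 𝒳 → 𝒯} {Mt : Model 𝒯 Θ}
    (hMt : M.IsModelOfStatistic t Mt) (ht : Measurable t) (k : ℕ) :
    (M.replicate k).IsModelOfStatistic (fun x i => t (x i)) (Mt.replicate k) := by
  intro θ
  have : SigmaFinite ((M.law θ).map t) := by rw [hMt θ]; infer_instance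
  rw [Model.law_replicate, Model.law_replicate, Measure.pi_map_pi fun _ => ht.aemeasurable, hMt θ]

theorem Model.Factorizes.replicate {M : Model 𝒳 Θ} {τ : Measure Θ} {t : 𝒳 → 𝒯}
    {Mt : Model 𝒯 Θ} {h : 𝒳 → ℝ≥0∞} (hF : M.Factorizes τ t Mt h) (k : ℕ) :
    (M.replicate k).Factorizes τ (fun x i => t (x i)) (Mt.replicate k) fun x => ∏ i, h (x i) := by
  have := M.sigmaFinite_ref
  refine ⟨Finset.measurable_prod _ fun i _ => hF.1.comp (measurable_pi_apply i), ?_⟩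
  filter_upwards [hF.2] with θ hθ
  have hall : ∀ᵐ x : Fin k → 𝒳 ∂(M.replicate k).ref,
      ∀ i, (M.p (x i) θ : ℝ≥0∞) = h (x i) * Mt.p (t (x i)) θ :=
    eventually_all.2 fun i =>
      (Measure.tendsto_eval_ae_ae (μ := fun _ : Fin k => M.ref) (i := i)).eventually hθ
  filter_upwards [hall] with x hx
  simp only [Model.replicate, ENNReal.ofNNReal_finsetProd, hx, Finset.prod_mul_distrib]

/-! ### Observed data and reference priors -/

/-- Almost every observation from the predictive law has a finite positive factor. -/
theorem Model.Factorizes.ae_predictiveLaw {M : Model 𝒳 Θ} {τ : Measure Θ} [SFinite τ] {t : 𝒳 → 𝒯}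
    {Mt : Model 𝒯 Θ} {h : 𝒳 → ℝ≥0∞} (hF : M.Factorizes τ t Mt h) (ht : Measurable t)
    {π : Θ → ℝ≥0} (hπ : Measurable π) :
    ∀ᵐ x ∂M.predictiveLaw τ π, ∃ c : ℝ≥0, 0 < c ∧ ∀ᵐ θ ∂τ, M.p x θ = c * Mt.p (t x) θ := by
  rw [Model.predictiveLaw, ae_withDensity_iff (M.measurable_predictive τ hπ)]
  filter_upwards [hF.ae_ae ht] with x hx hne
  -- Predictive-almost surely the predictive density is nonzero; either value `0` or `∞` of `h x`
  -- would make almost all densities at `x` vanish.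
  have hnz : ¬ ∀ᵐ θ ∂τ, (M.p x θ : ℝ≥0∞) = 0 := by
    intro h0
    refine hne ?_
    rw [Model.predictive, lintegral_congr_ae (g := 0), lintegral_zero_fun]
    filter_upwards [h0] with θ hθ
    simp [hθ]
  have h0 : h x ≠ 0 := fun e => hnz (hx.mono fun θ hθ => by rw [hθ, e, zero_mul])
  have htop : h x ≠ ∞ := by
    refine fun e => hnz (hx.mono fun θ hθ => ?_)
    by_contra hp
    rw [e, ENNReal.top_mul (fun e' => hp (by rw [hθ, e', mul_zero]))] at hθ
    exact ENNReal.coe_ne_top hθ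
  lift h x to ℝ≥0 using htop with c
  refine ⟨c, pos_iff_ne_zero.2 (by simpa using h0), hx.mono fun θ hθ => ?_⟩
  exact_mod_cast hθ

theorem Model.isFiniteMeasure_predictiveLaw (M : Model 𝒳 Θ) {τ : Measure Θ} [SFinite τ]
    {π : Θ → ℝ≥0} (hπ : IsProperPrior τ π) : IsFiniteMeasure (M.predictiveLaw τ π) :=
  isFiniteMeasure_withDensity (by rw [M.lintegral_predictive τ hπ.1, hπ.2]; exact ENNReal.one_ne_top)

/-- Marginal log-likelihoods differ by a constant if the densities factorize at the data. -/
theorem Model.exists_logL_eq_add {M : Model 𝒳 Θ} {τ : Measure Θ} {t : 𝒳 → 𝒯} {Mt : Model 𝒯 Θ}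
    {n : ℕ} {X : Fin n → 𝒳}
    (hX : ∀ m, ∃ c : ℝ≥0, 0 < c ∧ ∀ᵐ θ ∂τ, M.p (X m) θ = c * Mt.p (t (X m)) θ) :
    ∃ C : ℝ, ∀ π : Θ → ℝ≥0, IsProperPrior τ π →
      M.logL τ X π = (C : EReal) + Mt.logL τ (fun m => t (X m)) π := by
  choose c hc hcX using hX
  have hpos : 0 < ∏ m, c m := Finset.prod_pos fun m _ => hc m
  refine ⟨Real.log ((∏ m, c m : ℝ≥0) : ℝ), fun π hπ => ?_⟩
  have h : ∀ m, M.predictive τ π (X m) = c m * Mt.predictive τ π (t (X m)) := fun m =>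
    Model.predictive_eq_mul ((hcX m).mono fun θ hθ => by exact_mod_cast hθ) hπ.1
  rw [Model.logL, Model.logL, Finset.prod_congr rfl fun m _ => h m, Finset.prod_mul_distrib,
    ENNReal.log_mul_add, ← ENNReal.ofNNReal_finsetProd, ← ENNReal.ofReal_coe_nnreal,
    ENNReal.log_ofReal_of_pos (by exact_mod_cast hpos)]

/-- A finite shift fixes `⊥` and `⊤`, so the convention for `∞ - ∞` does no harm; only the case of
two reals needs arithmetic. -/
theorem add_coe_sub_add_coe (C : ℝ) (a b : EReal) : ((C : EReal) + a) - (C + b) = a - b := by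
  induction a <;> induction b <;> first | rfl | skip
  norm_cast
  ring

/-- Two models with the same expected information, whose log-likelihoods at the data differ by a
constant, have the same empirical reference priors. -/
theorem Model.isEmpiricalReferencePrior_congr {M : Model 𝒳 Θ} {Mt : Model 𝒯 Θ} {τ : Measure Θ}
    (hinfo : ∀ π : Θ → ℝ≥0, IsProperPrior τ π → ∀ k : ℕ,
      (M.replicate k).info τ π = (Mt.replicate k).info τ π)
    {n : ℕ} {X : Fin n → 𝒳} {T : Fin n → 𝒯} {C : ℝ}
    (hC : ∀ π : Θ → ℝ≥0, IsProperPrior τ π → M.logL τ X π = (C : EReal) + Mt.logL τ T π)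
    (𝒬 : Set (Θ → ℝ≥0)) (γ : ℝ) (π : Θ → ℝ≥0) :
    M.IsEmpiricalReferencePrior τ 𝒬 X γ π ↔ Mt.IsEmpiricalReferencePrior τ 𝒬 T γ π := by
  refine and_congr_right fun _ => and_congr_right fun hπ => forall_congr' fun π' =>
    forall_congr' fun _ => forall_congr' fun hπ' => ?_
  simp only [hinfo π hπ, hinfo π' hπ', hC π hπ, hC π' hπ', add_assoc, add_coe_sub_add_coe]

end Model

end EmpiricalBayes

theorem theorem4 {𝒳 𝒯 Θ : Type*} [MeasurableSpace 𝒳] [MeasurableSpace 𝒯] [MeasurableSpace Θ]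
    (τ : Measure Θ) [SigmaFinite τ]
    (M : EmpiricalBayes.Model 𝒳 Θ) (t : 𝒳 → 𝒯) (ht : M.IsSufficient t)
    (Mt : EmpiricalBayes.Model 𝒯 Θ) (hMt : M.IsModelOfStatistic t Mt) :
    -- the expected information is preserved
    (∀ π : Θ → ℝ≥0, EmpiricalBayes.IsProperPrior τ π → ∀ k : ℕ,
      (M.replicate k).info τ π = (Mt.replicate k).info τ π) ∧
    -- almost every sample drawn from `p(x)`, whatever the true prior `p₀` is
    (∀ p₀ : Θ → ℝ≥0, EmpiricalBayes.IsProperPrior τ p₀ → ∀ n : ℕ,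
      ∀ᵐ X : Fin n → 𝒳 ∂(Measure.pi fun _ => M.predictiveLaw τ p₀),
        (∃ C : ℝ, ∀ π : Θ → ℝ≥0, EmpiricalBayes.IsProperPrior τ π →
          M.logL τ X π = (C : EReal) + Mt.logL τ (fun m => t (X m)) π) ∧
        ∀ (𝒬 : Set (Θ → ℝ≥0)) (γ : ℝ), 0 < γ → ∀ π : Θ → ℝ≥0,
          (M.IsEmpiricalReferencePrior τ 𝒬 X γ π ↔
            Mt.IsEmpiricalReferencePrior τ 𝒬 (fun m => t (X m)) γ π)) ∧
    -- every sample at whose points the versions of the densities factorize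
    (∀ (n : ℕ) (X : Fin n → 𝒳),
      (∀ m, ∃ c : ℝ≥0, 0 < c ∧ ∀ᵐ θ ∂τ, M.p (X m) θ = c * Mt.p (t (X m)) θ) →
        (∃ C : ℝ, ∀ π : Θ → ℝ≥0, EmpiricalBayes.IsProperPrior τ π →
          M.logL τ X π = (C : EReal) + Mt.logL τ (fun m => t (X m)) π) ∧
        ∀ (𝒬 : Set (Θ → ℝ≥0)) (γ : ℝ), 0 < γ → ∀ π : Θ → ℝ≥0,
          (M.IsEmpiricalReferencePrior τ 𝒬 X γ π ↔
            Mt.IsEmpiricalReferencePrior τ 𝒬 (fun m => t (X m)) γ π)) := by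
  obtain ⟨h, hF⟩ := ht.exists_factorizes (τ := τ) hMt
  have hinfo : ∀ π : Θ → ℝ≥0, EmpiricalBayes.IsProperPrior τ π → ∀ k : ℕ,
      (M.replicate k).info τ π = (Mt.replicate k).info τ π := fun π hπ k =>
    (hF.replicate k).info_eq (measurable_pi_lambda _ fun i => ht.1.comp (measurable_pi_apply i))
      (hMt.replicate ht.1 k) hπ.1
  have hdata : ∀ (n : ℕ) (X : Fin n → 𝒳),
      (∀ m, ∃ c : ℝ≥0, 0 < c ∧ ∀ᵐ θ ∂τ, M.p (X m) θ = c * Mt.p (t (X m)) θ) →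
        (∃ C : ℝ, ∀ π : Θ → ℝ≥0, EmpiricalBayes.IsProperPrior τ π →
          M.logL τ X π = (C : EReal) + Mt.logL τ (fun m => t (X m)) π) ∧
        ∀ (𝒬 : Set (Θ → ℝ≥0)) (γ : ℝ), 0 < γ → ∀ π : Θ → ℝ≥0,
          (M.IsEmpiricalReferencePrior τ 𝒬 X γ π ↔
            Mt.IsEmpiricalReferencePrior τ 𝒬 (fun m => t (X m)) γ π) := by
    intro n X hX
    obtain ⟨C, hC⟩ := EmpiricalBayes.Model.exists_logL_eq_add hX
    exact ⟨⟨C, hC⟩, fun 𝒬 γ _ π =>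
      EmpiricalBayes.Model.isEmpiricalReferencePrior_congr hinfo hC 𝒬 γ π⟩
  refine ⟨hinfo, fun p₀ hp₀ n => ?_, hdata⟩
  -- Finiteness lets null sets of one coordinate pull back to null sets of the product law.
  have := M.isFiniteMeasure_predictiveLaw hp₀
  have hall : ∀ᵐ X : Fin n → 𝒳 ∂(Measure.pi fun _ => M.predictiveLaw τ p₀),
      ∀ m, ∃ c : ℝ≥0, 0 < c ∧ ∀ᵐ θ ∂τ, M.p (X m) θ = c * Mt.p (t (X m)) θ :=
    eventually_all.2 fun m => (Measure.tendsto_eval_ae_ae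
      (μ := fun _ : Fin n => M.predictiveLaw τ p₀) (i := m)).eventually
        (hF.ae_predictiveLaw ht.1 hp₀.1)
  filter_upwards [hall] with X hX using hdata n X hX
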